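/- Conventions. Let $\mathbb{M}=(M,d)$ be an ultrametric space. For $a\in M$ let $\mathrm{Spec}(\mathbb{M},a)=\{d(a,x):x\in M\}$, and let $\mathrm{Nerv}(\mathbb{M})$ be the set of closed balls $B'(a,r)=\{x: d(a,x)\le r\}$ with $a\in M$ and $r\in\mathrm{Spec}(\mathbb{M},a)$. Write $\delta(B)$ for the diameter of $B$. If $\delta(B)>0$, a son of $B$ is an open ball of radius $\delta(B)$ included in $B$. "$\mathbb{M}$ has infinitely many sons" means that the set $M$ itself has infinitely many sons. $(\mathrm{Nerv}(\mathbb{M}),\supseteq)$ is well founded if there is no infinite strictly increasing sequence (for inclusion) of members of $\mathrm{Nerv}(\mathbb{M})$. An ultrametric monoid is an ultrametric space $\mathbb{M}$ with a monoid operation $+$ on $M$ such that $d(z+x,z+y)=d(x,y)=d(x+z,y+z)$ for all $x,y,z$. A path of $\mathbb{M}$ is a set of balls obtained as follows from a finite non-empty set $\{B_0,\dots,B_{n-1}\}\subseteq\mathrm{Nerv}(\mathbb{M})$ with $\delta(B_0)>\dots>\delta(B_{n-1})$: with $\beta_i=\delta(B_i)$ and $\beta_{-1}=+\infty$, it is $$\bigcup_{i<n}\{C\in\mathrm{Nerv}(\mathbb{M})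 : C\supseteq B_i,\ \delta(C)<\beta_{i-1}\}.$$ For a path $\mathcal{I}$ let $\delta(\mathcal{I})$ be the least of the diameters of its members. For paths $\mathcal{I},\mathcal{J}$ put $\mathcal{I}\le\mathcal{J}$ if $\mathcal{I}=\{B\in\mathcal{J}:\delta(B)\ge\beta\}$ for some $\beta\in\{\delta(B):B\in\mathcal{J}\}$; this is a partial order in which any two paths have an infimum $\mathcal{I}\wedge\mathcal{J}$. The path extension $\mathrm{Path}(\mathbb{M})$ is the set of paths $\mathcal{I}$ with $\delta(\mathcal{I})=0$, with the distance $d(\mathcal{I},\mathcal{J})=\delta(\mathcal{I}\wedge\mathcal{J})$; it is an ultrametric space. An embedding of a metric space $\mathbb{X}=(X,d)$ is a distance-preserving map $X\to X$. $\mathbb{X}$ is spec-endogeneous if every distance-preserving map $f:A\to X$ with $A\subseteq X$ finite and $\mathrm{Spec}(\mathbb{X},x)\subseteq\mathrm{Spec}(\mathbb{X},f(x))$ for all $x\in A$ extends to an embedding of $\mathbb{X}$. $\mathbb{X}$ is indivisible if for every partition of $X$ into two parts, one of the parts contains an isometric copy of $\mathbb{X}$; it is hereditarily indivisible if $\mathbb{X}$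 is indivisible and every (open or closed) ball of $\mathbb{X}$, as a metric subspace, is indivisible. Theorem. Let $\mathbb{M}$ be a countable ultrametric monoid such that $(\mathrm{Nerv}(\mathbb{M}),\supseteq)$ is well founded and $\mathbb{M}$ has infinitely many sons. Then the path extension $\mathrm{Path}(\mathbb{M})$ is spec-endogeneous and hereditarily indivisible. -/

import Mathlib

namespace PathExtension

/-! ### Metric notions -/

section Metric

variable {X : Type*} [MetricSpace X]

/-- The spectrum of a point: the set of distances from this point. -/
def spec (a : X) : Set ℝ := Set.range (fun x => dist a x)

variable (X) in
/-- The nerve of `X`: the closed balls whose radius is attained from their centre. -/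
def nerve : Set (Set X) := {B | ∃ a : X, ∃ r ∈ spec a, B = Metric.closedBall a r}

/-- The sons of `B`: the open balls of radius `diam B` included in `B`, when `diam B > 0`. -/
def sons (B : Set X) : Set (Set X) :=
  {S | 0 < Metric.diam B ∧ ∃ a : X, S = Metric.ball a (Metric.diam B) ∧ S ⊆ B}

variable (X) in
/-- Every local spec-embedding of `X` with finite domain `A` extends to an embedding of `X`. -/
def SpecEndogeneous : Prop :=
  ∀ (A : Set X) (f : X → X), A.Finite →
    (∀ x ∈ A, ∀ y ∈ A, dist (f x) (f y) = dist x y) →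
    (∀ x ∈ A, spec x ⊆ spec (f x)) →
    ∃ g : X → X, Isometry g ∧ ∀ x ∈ A, g x = f x

variable (X) in
/-- For every partition of `X` into two parts, one part contains an isometric copy of `X`. -/
def Indivisible : Prop :=
  ∀ A : Set X, (∃ f : X → X, Isometry f ∧ ∀ x, f x ∈ A) ∨ (∃ f : X → X, Isometry f ∧ ∀ x, f x ∈ Aᶜ)

variable (X) in
/-- `X` is indivisible, and so is every open or closed ball of `X`. -/
def HereditarilyIndivisible : Prop :=
  Indivisible X ∧ ∀ (a : X) (r : ℝ),
    Indivisible (Metric.ball a r) ∧ Indivisible (Metric.closedBall a r)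

end Metric

/-! ### Paths of balls -/

section Paths

variable {M : Type*} [MetricSpace M]

/-- The set of balls generated by `𝓑`. If the members of `𝓑` are `B₀, …, Bₙ₋₁` with diameters
`β₀ > … > βₙ₋₁`, and `β₋₁ = +∞`, then this is the union over `i` of the sets of the balls `C` of
the nerve with `Bᵢ ⊆ C` and `diam C < βᵢ₋₁`. -/
def gen (𝓑 : Set (Set M)) : Set (Set M) :=
  {C | C ∈ nerve M ∧ ∃ B ∈ 𝓑, B ⊆ C ∧
    ∀ B' ∈ 𝓑, Metric.diam B < Metric.diam B' → Metric.diam C < Metric.diam B'}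

/-- A path is a set of balls generated by a finite non-empty slim subset `𝓑` of the nerve, where
slim means that distinct members have distinct diameters. -/
def IsPath (I : Set (Set M)) : Prop :=
  ∃ 𝓑 : Set (Set M), 𝓑.Finite ∧ 𝓑.Nonempty ∧ 𝓑 ⊆ nerve M ∧ Set.InjOn Metric.diam 𝓑 ∧ I = gen 𝓑

variable (M) in
/-- The set of all paths. -/
def BallPath : Type _ := {I : Set (Set M) // IsPath I}

/-- The least diameter of a member of the path (it is attained, see `delta_isLeast`). -/
noncomputable def delta (I : BallPath M) : ℝ := sInf (Metric.diam '' I.1)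

theorem nerve_attained [IsUltrametricDist M] {B : Set M} (hB : B ∈ nerve M) {b : M} (hb : b ∈ B) :
    B = Metric.closedBall b (Metric.diam B) ∧ ∃ x ∈ B, dist b x = Metric.diam B := by
  obtain ⟨a, r, ⟨x, hx⟩, rfl⟩ := hB
  simp only at hx
  have hxm : x ∈ Metric.closedBall a r := by rw [Metric.mem_closedBall, dist_comm, hx]
  have hr : 0 ≤ r := hx ▸ dist_nonneg
  have ham : a ∈ Metric.closedBall a r := Metric.mem_closedBall_self hr
  have hd : Metric.diam (Metric.closedBall a r) = r := by
    apply le_antisymm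
    · refine Metric.diam_le_of_forall_dist_le hr fun y hy z hz => ?_
      refine (dist_triangle_max y a z).trans (max_le hy ?_)
      rw [dist_comm]; exact hz
    · have h := Metric.dist_le_diam_of_mem Metric.isBounded_closedBall ham hxm
      rwa [hx] at h
  rw [hd]
  have hball : Metric.closedBall a r = Metric.closedBall b r :=
    IsUltrametricDist.closedBall_eq_of_mem hb
  refine ⟨hball, ?_⟩
  rcases (dist_nonneg.trans hb).eq_or_lt with h0 | h0
  · refine ⟨b, hb, ?_⟩; rw [dist_self, h0]
  by_cases h : dist b a = r
  · exact ⟨a, ham, h⟩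
  · refine ⟨x, hxm, ?_⟩
    have h1 : dist b a < r := lt_of_le_of_ne hb h
    have h2 : dist b x ≤ r := by
      have := hball ▸ hxm
      rw [dist_comm]; exact this
    have h3 := dist_triangle_max a b x
    rw [hx, dist_comm a b] at h3
    rcases le_max_iff.1 h3 with h4 | h4
    · linarith
    · exact le_antisymm h2 h4

theorem nerve_nonempty {B : Set M} (hB : B ∈ nerve M) : B.Nonempty := by
  obtain ⟨a, r, ⟨x, hx⟩, rfl⟩ := hB
  exact ⟨a, Metric.mem_closedBall_self (hx ▸ dist_nonneg)⟩

theorem nerve_bounded {B : Set M} (hB : B ∈ nerve M) : Bornology.IsBounded B := by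
  obtain ⟨a, r, -, rfl⟩ := hB
  exact Metric.isBounded_closedBall

theorem nerve_subset [IsUltrametricDist M] {B C : Set M} (hB : B ∈ nerve M) (hC : C ∈ nerve M)
    {b : M} (hbB : b ∈ B) (hbC : b ∈ C) (h : Metric.diam B ≤ Metric.diam C) : B ⊆ C := by
  rw [(nerve_attained hB hbB).1, (nerve_attained hC hbC).1]
  exact Metric.closedBall_subset_closedBall h

/-- Two balls of the nerve are included in a least ball of the nerve. -/
theorem nerve_sup [IsUltrametricDist M] {B C : Set M} (hB : B ∈ nerve M) (hC : C ∈ nerve M) :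
    ∃ D ∈ nerve M, B ⊆ D ∧ C ⊆ D ∧ ∀ E ∈ nerve M, B ⊆ E → C ⊆ E → D ⊆ E := by
  obtain ⟨b, hb⟩ := nerve_nonempty hB
  obtain ⟨c, hc⟩ := nerve_nonempty hC
  by_cases h : c ∈ B
  · rcases le_total (Metric.diam B) (Metric.diam C) with h1 | h1
    · exact ⟨C, hC, nerve_subset hB hC h hc h1, subset_rfl, fun E _ _ h => h⟩
    · exact ⟨B, hB, subset_rfl, nerve_subset hC hB hc h h1, fun E _ h _ => h⟩
  by_cases h' : b ∈ C
  · rcases le_total (Metric.diam B) (Metric.diam C) with h1 | h1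
    · exact ⟨C, hC, nerve_subset hB hC hb h' h1, subset_rfl, fun E _ _ h => h⟩
    · exact ⟨B, hB, subset_rfl, nerve_subset hC hB h' hb h1, fun E _ h _ => h⟩
  have h1 : Metric.diam B ≤ dist b c := by
    by_contra hlt
    refine h ?_
    rw [(nerve_attained hB hb).1, Metric.mem_closedBall, dist_comm]
    exact (not_le.1 hlt).le
  have h2 : Metric.diam C ≤ dist b c := by
    by_contra hlt
    refine h' ?_
    rw [(nerve_attained hC hc).1, Metric.mem_closedBall]
    exact (not_le.1 hlt).le
  have hD : Metric.closedBall b (dist b c) = Metric.closedBall c (dist b c) :=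
    IsUltrametricDist.closedBall_eq_of_mem (by rw [Metric.mem_closedBall, dist_comm])
  refine ⟨Metric.closedBall b (dist b c), ⟨b, dist b c, ⟨c, rfl⟩, rfl⟩, ?_, ?_, ?_⟩
  · rw [(nerve_attained hB hb).1]
    exact Metric.closedBall_subset_closedBall h1
  · rw [hD, (nerve_attained hC hc).1]
    exact Metric.closedBall_subset_closedBall h2
  · intro E hE hBE hCE
    rw [(nerve_attained hE (hBE hb)).1]
    exact Metric.closedBall_subset_closedBall
      (Metric.dist_le_diam_of_mem (nerve_bounded hE) (hBE hb) (hCE hc))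

theorem delta_isLeast (I : BallPath M) : IsLeast (Metric.diam '' I.1) (delta I) := by
  obtain ⟨_, 𝓑, hfin, hne, hsub, -, rfl⟩ := I
  obtain ⟨B, hB, hmin⟩ := hfin.exists_minimalFor Metric.diam 𝓑 hne
  have hmin' : ∀ C ∈ 𝓑, Metric.diam B ≤ Metric.diam C := fun C hC => by
    rcases le_total (Metric.diam B) (Metric.diam C) with h | h
    · exact h
    · exact hmin hC h
  have hl : IsLeast (Metric.diam '' gen 𝓑) (Metric.diam B) := by
    refine ⟨⟨B, ⟨hsub hB, B, hB, subset_rfl, fun _ _ h => h⟩, rfl⟩, ?_⟩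
    rintro _ ⟨C, ⟨hC, B', hB', hsubC, -⟩, rfl⟩
    exact (hmin' B' hB').trans (Metric.diam_mono hsubC (nerve_bounded hC))
  change IsLeast _ (sInf (Metric.diam '' gen 𝓑))
  rw [hl.csInf_eq]
  exact hl

/-- `I ≤ J` if `I` is an initial segment of `J`, that is, if it consists of the members of `J`
whose diameter is at least `β`, for some `β` that is the diameter of a member of `J`. -/
instance : PartialOrder (BallPath M) where
  le I J := ∃ β ∈ Metric.diam '' J.1, I.1 = J.1 \ {B | Metric.diam B < β}
  le_refl I := ⟨delta I, (delta_isLeast I).1, by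
    ext B
    simp only [Set.mem_sdiff, Set.mem_ofPred_eq, not_lt]
    exact ⟨fun h => ⟨h, (delta_isLeast I).2 ⟨B, h, rfl⟩⟩, fun h => h.1⟩⟩
  le_trans I J K := by
    rintro ⟨β, ⟨B, hB, rfl⟩, hI⟩ ⟨γ, hγ, hJ⟩
    rw [hJ, Set.mem_sdiff, Set.mem_ofPred_eq, not_lt] at hB
    refine ⟨Metric.diam B, ⟨B, hB.1, rfl⟩, ?_⟩
    rw [hI, hJ]
    ext C
    simp only [Set.mem_sdiff, Set.mem_ofPred_eq, not_lt]
    exact ⟨fun h => ⟨h.1.1, h.2⟩, fun h => ⟨⟨h.1, hB.2.trans h.2⟩, h.2⟩⟩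
  le_antisymm I J := by
    rintro ⟨β, -, hI⟩ ⟨γ, -, hJ⟩
    refine Subtype.ext (Set.Subset.antisymm ?_ ?_)
    · rw [hI]; exact Set.sdiff_subset
    · rw [hJ]; exact Set.sdiff_subset

theorem le_def {I J : BallPath M} :
    I ≤ J ↔ ∃ β ∈ Metric.diam '' J.1, I.1 = J.1 \ {B | Metric.diam B < β} := Iff.rfl

theorem delta_eq {I J : BallPath M} {β : ℝ} (hβ : β ∈ Metric.diam '' J.1)
    (h : I.1 = J.1 \ {B | Metric.diam B < β}) : delta I = β := by
  obtain ⟨B, hB, rfl⟩ := hβ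
  refine (delta_isLeast I).unique ⟨⟨B, ?_, rfl⟩, ?_⟩
  · rw [h]; exact ⟨hB, by simp⟩
  · rintro _ ⟨C, hC, rfl⟩
    rw [h, Set.mem_sdiff, Set.mem_ofPred_eq, not_lt] at hC
    exact hC.2

theorem le_iff {I J : BallPath M} :
    I ≤ J ↔ delta I ∈ Metric.diam '' J.1 ∧ I.1 = J.1 \ {B | Metric.diam B < delta I} := by
  constructor
  · rintro ⟨β, hβ, h⟩
    rw [delta_eq hβ h]; exact ⟨hβ, h⟩
  · rintro ⟨h1, h2⟩; exact ⟨_, h1, h2⟩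

theorem delta_anti {I J : BallPath M} (h : I ≤ J) : delta J ≤ delta I :=
  (delta_isLeast J).2 (le_iff.1 h).1

theorem le_of_le_of_le {I J K : BallPath M} (hI : I ≤ K) (hJ : J ≤ K) (h : delta J ≤ delta I) :
    I ≤ J := by
  rw [le_iff] at hI hJ ⊢
  obtain ⟨⟨B, hB, hB'⟩, hI⟩ := hI
  refine ⟨⟨B, ?_, hB'⟩, ?_⟩
  · rw [hJ.2]; exact ⟨hB, by simpa [hB'] using h⟩
  · rw [hI, hJ.2]
    ext C
    simp only [Set.mem_sdiff, Set.mem_ofPred_eq, not_lt]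
    exact ⟨fun hC => ⟨⟨hC.1, h.trans hC.2⟩, hC.2⟩, fun hC => ⟨hC.1.1, hC.2⟩⟩

/-- An initial segment of a path that ends in a member of the path is a path. -/
theorem isPath_segment [IsUltrametricDist M] {I : Set (Set M)} (hI : IsPath I) {B : Set M}
    (hB : B ∈ I) : IsPath (I \ {C | Metric.diam C < Metric.diam B}) := by
  obtain ⟨𝓑, hfin, -, hsub, hinj, rfl⟩ := hI
  obtain ⟨hBn, Bi, hBi, hBiB, hBlt⟩ := hB
  refine ⟨insert B {C ∈ 𝓑 | Metric.diam B < Metric.diam C},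
    (hfin.subset (Set.sep_subset _ _)).insert B, Set.insert_nonempty _ _, ?_, ?_, ?_⟩
  · rintro C (rfl | hC)
    · exact hBn
    · exact hsub hC.1
  · rintro C (rfl | hC) D (rfl | hD) h
    · rfl
    · exact absurd hD.2 (by rw [h]; exact lt_irrefl _)
    · exact absurd hC.2 (by rw [h]; exact lt_irrefl _)
    · exact hinj hC.1 hD.1 h
  · have hBib : Metric.diam Bi ≤ Metric.diam B := Metric.diam_mono hBiB (nerve_bounded hBn)
    ext C
    constructor
    · rintro ⟨⟨hCn, Bk, hBk, hBkC, hClt⟩, hC⟩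
      simp only [Set.mem_ofPred_eq, not_lt] at hC
      refine ⟨hCn, ?_⟩
      by_cases hk : Metric.diam B < Metric.diam Bk
      · refine ⟨Bk, Or.inr ⟨hBk, hk⟩, hBkC, ?_⟩
        rintro B' (rfl | hB') h
        · exact absurd h hk.not_gt
        · exact hClt B' hB'.1 h
      · have hki : Bk = Bi := by
          refine hinj hBk hBi (le_antisymm ?_ ?_)
          · by_contra hlt
            exact hk (hBlt Bk hBk (not_le.1 hlt))
          · by_contra hlt
            exact absurd (hClt Bi hBi (not_le.1 hlt)) (not_lt.2 (hBib.trans hC))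
        subst hki
        obtain ⟨b, hb⟩ := nerve_nonempty (hsub hBk)
        refine ⟨B, Or.inl rfl, nerve_subset hBn hCn (hBiB hb) (hBkC hb) hC, ?_⟩
        rintro B' (rfl | hB') h
        · exact absurd h (lt_irrefl _)
        · exact hClt B' hB'.1 (hBib.trans_lt h)
    · rintro ⟨hCn, Bk, hBk | hBk, hBkC, hClt⟩
      · subst hBk
        refine ⟨⟨hCn, Bi, hBi, hBiB.trans hBkC, fun B' hB' h => ?_⟩, ?_⟩
        · exact hClt B' (Or.inr ⟨hB', hBlt B' hB' h⟩) (hBlt B' hB' h)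
        · simpa using Metric.diam_mono hBkC (nerve_bounded hCn)
      · refine ⟨⟨hCn, Bk, hBk.1, hBkC, fun B' hB' h => ?_⟩, ?_⟩
        · exact hClt B' (Or.inr ⟨hB', hBk.2.trans h⟩) h
        · simpa using hBk.2.le.trans (Metric.diam_mono hBkC (nerve_bounded hCn))

/-- Two paths have a greatest common initial segment. -/
theorem exists_isGLB [IsUltrametricDist M] (I J : BallPath M) :
    ∃ K : BallPath M, IsGLB {I, J} K := by
  classical
  let S : Set (Set M) := {B | B ∈ I.1 ∧ B ∈ J.1 ∧
    I.1 \ {C | Metric.diam C < Metric.diam B} = J.1 \ {C | Metric.diam C < Metric.diam B}}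
  suffices h : ∃ D ∈ S, ∀ B ∈ S, Metric.diam D ≤ Metric.diam B by
    obtain ⟨D, ⟨hDI, hDJ, hD⟩, hmin⟩ := h
    refine ⟨⟨_, isPath_segment I.2 hDI⟩, ?_, ?_⟩
    · rintro _ (rfl | rfl)
      · exact ⟨_, ⟨D, hDI, rfl⟩, rfl⟩
      · exact ⟨_, ⟨D, hDJ, rfl⟩, hD⟩
    · intro K' hK'
      have hKI : K' ≤ I := hK' (by simp)
      have hKJ : K' ≤ J := hK' (by simp)
      rw [le_iff] at hKI hKJ
      obtain ⟨B, hB, hBd⟩ := (delta_isLeast K').1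
      have hBI : B ∈ I.1 := by rw [hKI.2] at hB; exact hB.1
      have hBJ : B ∈ J.1 := by rw [hKJ.2] at hB; exact hB.1
      have hBS : B ∈ S := ⟨hBI, hBJ, by rw [hBd, ← hKI.2, ← hKJ.2]⟩
      have hle := hmin B hBS
      refine ⟨Metric.diam B, ⟨B, ⟨hBI, by simpa using hle⟩, rfl⟩, ?_⟩
      rw [hKI.2, ← hBd]
      ext C
      simp only [Set.mem_sdiff, Set.mem_ofPred_eq, not_lt]
      exact ⟨fun hC => ⟨⟨hC.1, hle.trans hC.2⟩, hC.2⟩, fun hC => ⟨hC.1.1, hC.2⟩⟩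
  obtain ⟨I, 𝓑, hfB, hneB, hsubB, hinjB, rfl⟩ := I
  obtain ⟨J, 𝓒, hfC, hneC, hsubC, hinjC, rfl⟩ := J
  -- the members of `S` attached to given generators, if any, have a least one
  have key : ∀ B₁ ∈ 𝓑, ∀ C₁ ∈ 𝓒, ∀ D ∈ nerve M, B₁ ⊆ D → C₁ ⊆ D →
      (∀ E ∈ nerve M, B₁ ⊆ E → C₁ ⊆ E → D ⊆ E) → ∀ B ∈ S, B₁ ⊆ B → C₁ ⊆ B →
      (∀ B' ∈ 𝓑, Metric.diam B₁ < Metric.diam B' → Metric.diam B < Metric.diam B') →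
      (∀ B' ∈ 𝓒, Metric.diam C₁ < Metric.diam B' → Metric.diam B < Metric.diam B') →
      D ∈ S ∧ Metric.diam D ≤ Metric.diam B := by
    intro B₁ hB₁ C₁ hC₁ D hD hBD hCD hleast B hB hBB hCB hltB hltC
    have hBn : B ∈ nerve M := hB.1.1
    have hDB : Metric.diam D ≤ Metric.diam B :=
      Metric.diam_mono (hleast B hBn hBB hCB) (nerve_bounded hBn)
    have aux : ∀ (𝓐 𝓐' : Set (Set M)) (A A' : Set M), 𝓐 ⊆ nerve M → Set.InjOn Metric.diam 𝓐 →
        A ∈ 𝓐 → A' ∈ 𝓐' → A ⊆ D → A' ⊆ D →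
        (∀ B' ∈ 𝓐, Metric.diam A < Metric.diam B' → Metric.diam B < Metric.diam B') →
        (∀ B' ∈ 𝓐', Metric.diam A' < Metric.diam B' → Metric.diam B < Metric.diam B') →
        gen 𝓐 \ {C | Metric.diam C < Metric.diam B} ⊆ gen 𝓐' →
        gen 𝓐 \ {C | Metric.diam C < Metric.diam D} ⊆
          gen 𝓐' \ {C | Metric.diam C < Metric.diam D} := by
      rintro 𝓐 𝓐' A A' hsub hinj hA hA' hAD hA'D hlt hlt' hBsub E ⟨hE, hED⟩
      refine ⟨?_, hED⟩
      by_cases hEB : Metric.diam E < Metric.diam B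
      · obtain ⟨hEn, Ak, hAk, hAkE, hElt⟩ := hE
        simp only [Set.mem_ofPred_eq, not_lt] at hED
        have hAd : Metric.diam A ≤ Metric.diam D := Metric.diam_mono hAD (nerve_bounded hD)
        have : Ak = A := by
          refine hinj hAk hA (le_antisymm ?_ ?_)
          · by_contra hl
            have h1 := hlt Ak hAk (not_le.1 hl)
            have h2 := Metric.diam_mono hAkE (nerve_bounded hEn)
            linarith
          · by_contra hl
            have h1 := hElt A hA (not_le.1 hl)
            linarith
        subst this
        obtain ⟨b, hb⟩ := nerve_nonempty (hsub hA)
        have hDE : D ⊆ E := nerve_subset hD hEn (hAD hb) (hAkE hb) hED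
        exact ⟨hEn, A', hA', hA'D.trans hDE, fun B' hB' h => hEB.trans (hlt' B' hB' h)⟩
      · exact hBsub ⟨hE, hEB⟩
    refine ⟨⟨⟨hD, B₁, hB₁, hBD, fun B' hB' h => hDB.trans_lt (hltB B' hB' h)⟩,
      ⟨hD, C₁, hC₁, hCD, fun B' hB' h => hDB.trans_lt (hltC B' hB' h)⟩, ?_⟩, hDB⟩
    refine Set.Subset.antisymm
      (aux 𝓑 𝓒 B₁ C₁ hsubB hinjB hB₁ hC₁ hBD hCD hltB hltC ?_)
      (aux 𝓒 𝓑 C₁ B₁ hsubC hinjC hC₁ hB₁ hCD hBD hltC hltB ?_)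
    · exact (hB.2.2.le).trans Set.sdiff_subset
    · exact (hB.2.2.ge).trans Set.sdiff_subset
  -- `S` is not empty
  have hSne : S.Nonempty := by
    obtain ⟨B₀, hB₀, hmaxB⟩ := hfB.exists_maximalFor Metric.diam 𝓑 hneB
    obtain ⟨C₀, hC₀, hmaxC⟩ := hfC.exists_maximalFor Metric.diam 𝓒 hneC
    have hmB : ∀ B ∈ 𝓑, Metric.diam B ≤ Metric.diam B₀ := fun B hB => by
      rcases le_total (Metric.diam B) (Metric.diam B₀) with h | h
      · exact h
      · exact hmaxB hB h
    have hmC : ∀ B ∈ 𝓒, Metric.diam B ≤ Metric.diam C₀ := fun B hB => by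
      rcases le_total (Metric.diam B) (Metric.diam C₀) with h | h
      · exact h
      · exact hmaxC hB h
    obtain ⟨D, hD, hBD, hCD, -⟩ := nerve_sup (hsubB hB₀) (hsubC hC₀)
    have aux : ∀ (𝓐 𝓐' : Set (Set M)) (A A' : Set M), 𝓐 ⊆ nerve M → Set.InjOn Metric.diam 𝓐 →
        A ∈ 𝓐 → A' ∈ 𝓐' → A ⊆ D → A' ⊆ D → (∀ B ∈ 𝓐, Metric.diam B ≤ Metric.diam A) →
        (∀ B ∈ 𝓐', Metric.diam B ≤ Metric.diam A') →
        gen 𝓐 \ {C | Metric.diam C < Metric.diam D} ⊆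
          gen 𝓐' \ {C | Metric.diam C < Metric.diam D} := by
      rintro 𝓐 𝓐' A A' hsub hinj hA hA' hAD hA'D hm hm' E ⟨⟨hEn, Ak, hAk, hAkE, hElt⟩, hED⟩
      refine ⟨?_, hED⟩
      simp only [Set.mem_ofPred_eq, not_lt] at hED
      have hAd : Metric.diam A ≤ Metric.diam D := Metric.diam_mono hAD (nerve_bounded hD)
      have : Ak = A := by
        refine hinj hAk hA (le_antisymm (hm Ak hAk) ?_)
        by_contra hl
        have h1 := hElt A hA (not_le.1 hl)
        linarith
      subst this
      obtain ⟨b, hb⟩ := nerve_nonempty (hsub hA)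
      have hDE : D ⊆ E := nerve_subset hD hEn (hAD hb) (hAkE hb) hED
      exact ⟨hEn, A', hA', hA'D.trans hDE, fun B' hB' h => absurd (hm' B' hB') (not_le.2 h)⟩
    exact ⟨D, ⟨hD, B₀, hB₀, hBD, fun B' hB' h => absurd (hmB B' hB') (not_le.2 h)⟩,
      ⟨hD, C₀, hC₀, hCD, fun B' hB' h => absurd (hmC B' hB') (not_le.2 h)⟩,
      Set.Subset.antisymm (aux 𝓑 𝓒 B₀ C₀ hsubB hinjB hB₀ hC₀ hBD hCD hmB hmC)
        (aux 𝓒 𝓑 C₀ B₀ hsubC hinjC hC₀ hB₀ hCD hBD hmC hmB)⟩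
  -- choose, among the finitely many joins of generators, a least one in `S`
  have hsup : ∀ p : Set M × Set M, ∃ D : Set M, p.1 ∈ 𝓑 → p.2 ∈ 𝓒 →
      (D ∈ nerve M ∧ p.1 ⊆ D ∧ p.2 ⊆ D ∧ ∀ E ∈ nerve M, p.1 ⊆ E → p.2 ⊆ E → D ⊆ E) := by
    intro p
    by_cases h : p.1 ∈ 𝓑 ∧ p.2 ∈ 𝓒
    · obtain ⟨D, hD⟩ := nerve_sup (hsubB h.1) (hsubC h.2)
      exact ⟨D, fun _ _ => hD⟩
    · exact ⟨∅, fun h1 h2 => absurd ⟨h1, h2⟩ h⟩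
  choose F hF using hsup
  have hfT : ((F '' (𝓑 ×ˢ 𝓒)) ∩ S).Finite := ((hfB.prod hfC).image F).inter_of_left S
  have hT : ∀ B ∈ S, ∃ D ∈ (F '' (𝓑 ×ˢ 𝓒)) ∩ S, Metric.diam D ≤ Metric.diam B := by
    intro B hB
    obtain ⟨⟨-, B₁, hB₁, hBB, hltB⟩, ⟨-, C₁, hC₁, hCB, hltC⟩, -⟩ := id hB
    obtain ⟨hD, hBD, hCD, hl⟩ := hF (B₁, C₁) hB₁ hC₁
    obtain ⟨h1, h2⟩ := key B₁ hB₁ C₁ hC₁ _ hD hBD hCD hl B hB hBB hCB hltB hltC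
    exact ⟨_, ⟨⟨(B₁, C₁), ⟨hB₁, hC₁⟩, rfl⟩, h1⟩, h2⟩
  obtain ⟨B, hB⟩ := hSne
  obtain ⟨D₀, hD₀, -⟩ := hT B hB
  obtain ⟨D, hD, hmin⟩ := hfT.exists_minimalFor Metric.diam _ ⟨D₀, hD₀⟩
  refine ⟨D, hD.2, fun B hB => ?_⟩
  obtain ⟨E, hE, hEB⟩ := hT B hB
  refine le_trans ?_ hEB
  rcases le_total (Metric.diam D) (Metric.diam E) with h | h
  · exact h
  · exact hmin hE h

/-- The meet of two paths: their greatest lower bound. -/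
noncomputable def meet [IsUltrametricDist M] (I J : BallPath M) : BallPath M :=
  (exists_isGLB I J).choose

theorem isGLB_meet [IsUltrametricDist M] (I J : BallPath M) : IsGLB {I, J} (meet I J) :=
  (exists_isGLB I J).choose_spec

theorem delta_meet_le_max [IsUltrametricDist M] (I J K : BallPath M) :
    delta (meet I K) ≤ max (delta (meet I J)) (delta (meet J K)) := by
  have h1 := isGLB_meet I J
  have h2 := isGLB_meet J K
  have h3 := isGLB_meet I K
  have hI : meet I J ≤ I := h1.1 (by simp)
  have hJ : meet I J ≤ J := h1.1 (by simp)
  have hJ' : meet J K ≤ J := h2.1 (by simp)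
  have hK : meet J K ≤ K := h2.1 (by simp)
  rcases le_total (delta (meet J K)) (delta (meet I J)) with h | h
  · have h4 := le_of_le_of_le hJ hJ' h
    have h5 : meet I J ≤ meet I K := h3.2 (by
      rintro _ (rfl | rfl)
      · exact hI
      · exact h4.trans hK)
    exact (delta_anti h5).trans (le_max_left _ _)
  · have h4 := le_of_le_of_le hJ' hJ h
    have h5 : meet J K ≤ meet I K := h3.2 (by
      rintro _ (rfl | rfl)
      · exact h4.trans hI
      · exact hK)
    exact (delta_anti h5).trans (le_max_right _ _)

/-! ### The path extension -/

variable (M) in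
/-- The path extension of `M`: the paths whose least diameter is `0`. -/
def PathExt : Type _ := {I : BallPath M // delta I = 0}

/-- The path extension is a metric space, where the distance of two paths is the least diameter of
a member of their meet. -/
noncomputable instance [IsUltrametricDist M] : MetricSpace (PathExt M) where
  dist I J := delta (meet I.1 J.1)
  dist_self I := by
    have h : meet I.1 I.1 = I.1 := (isGLB_meet I.1 I.1).unique (by simp)
    change delta (meet I.1 I.1) = 0
    rw [h]; exact I.2
  dist_comm I J := by
    have h : meet I.1 J.1 = meet J.1 I.1 :=
      (isGLB_meet I.1 J.1).unique (by rw [Set.pair_comm]; exact isGLB_meet J.1 I.1)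
    change delta (meet I.1 J.1) = delta (meet J.1 I.1)
    rw [h]
  dist_triangle I J K := by
    have h0 : ∀ L : BallPath M, 0 ≤ delta L := fun L => by
      obtain ⟨B, -, hB⟩ := (delta_isLeast L).1
      rw [← hB]; exact Metric.diam_nonneg
    refine (delta_meet_le_max I.1 J.1 K.1).trans (max_le ?_ ?_)
    · exact le_add_of_nonneg_right (h0 _)
    · exact le_add_of_nonneg_left (h0 _)
  eq_of_dist_eq_zero := by
    intro I J h
    change delta (meet I.1 J.1) = 0 at h
    have h1 := isGLB_meet I.1 J.1
    have hI : meet I.1 J.1 ≤ I.1 := h1.1 (by simp)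
    have hJ : meet I.1 J.1 ≤ J.1 := h1.1 (by simp)
    have hI' := le_of_le_of_le le_rfl hI (by rw [h, I.2])
    have hJ' := le_of_le_of_le le_rfl hJ (by rw [h, J.2])
    exact Subtype.ext ((hI'.antisymm hI).trans (hJ'.antisymm hJ).symm)

instance [IsUltrametricDist M] : IsUltrametricDist (PathExt M) :=
  ⟨fun I J K => delta_meet_le_max I.1 J.1 K.1⟩

end Paths

end PathExtension

/-! Four properties of a countable ultrametric space, collected in `Ample`, imply both conclusions;
the path extension has them.

Embeddings need not be onto, so a "forth" construction is enough (`exists_isometry_extension`). A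
new point `x`, with nearest point `x₀` in the current domain, is sent to a point at distance `dist
x₀ x` from the image of `x₀` and at least as far from the rest of the image; the ultrametric
inequality then fixes all the other distances. Spec-endogeneity follows by maintaining the inclusion
of spectra along the construction.

For indivisibility, suppose that `Aᶜ` contains no copy of the space. By `exists_noCopy_chain`, a
ball with no copy of itself in `Aᶜ` contains points around which all smaller balls, with radii in a
prescribed spectrum, have no such copy either. Otherwise copies inside disjoint smaller balls could
be glued into a copy of the large ball. The forth construction can thus keep every ball around the
image points free of copies; at radius `0` this says that the image lies in `A`. Ampleness passes to
balls, whence heredity.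

In the path extension the spectrum of a path is the set of diameters of its members, and it lies in
the spectrum of one point of `M`, because a sum dominates the spectra of its terms. Branching
(`exists_switch`) leaves a path at a ball `C` and descends to `b + m`, where `b` runs through
centres of infinitely many sons of `M`. The first balls met below `C` are pairwise disjoint, and a
path contains only finitely many of them, so some `b` avoids any finite set of paths. -/

namespace PathExtension

open IsUltrametricDist (closedBall_eq_of_mem)

/-! ### Building isometries one point at a time -/

section Extension

variable {X Y : Type*} [MetricSpace X] [IsUltrametricDist X] [MetricSpace Y] [IsUltrametricDist Y]

/-- A point at distance `t` from `x` is at distance `t` from `y` when `dist x y < t`; in the case of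
equality `x` itself is the witness. Hence nearby points have spectra that differ only below their
distance. -/
theorem spec_subset_of_dist_le {x y : X} {t : ℝ} (h : dist x y ≤ t) (ht : t ∈ spec x) :
    t ∈ spec y := by
  obtain ⟨z, hz⟩ := ht
  simp only at hz
  rcases h.lt_or_eq with h | h
  · refine ⟨z, ?_⟩
    simp only
    apply le_antisymm
    · refine (dist_triangle_max y x z).trans (max_le ?_ hz.le)
      rw [dist_comm]; exact h.le
    · by_contra hlt
      have := dist_triangle_max x y z
      rcases le_max_iff.1 this with h1 | h1 <;> linarith
  · exact ⟨x, by simp only; rw [dist_comm, h]⟩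

theorem zero_mem_spec {Z : Type*} [MetricSpace Z] (x : Z) : (0 : ℝ) ∈ spec x := ⟨x, dist_self x⟩

/-- A point at least as far from the image of a finite set as from the image of a nearest point is
at the right distance from all of this image. -/
theorem dist_eq_of_nearest {x x₀ a : X} {y y₀ b : Y} (hnear : dist x₀ x ≤ dist a x)
    (hb : dist y₀ b = dist x₀ a) (hy₀ : dist y₀ y = dist x₀ x) (hy : dist x₀ x ≤ dist y b) :
    dist y b = dist x a := by
  rw [dist_comm a x] at hnear
  have h1 := dist_triangle_max x x₀ a
  have h2 := dist_triangle_max y y₀ b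
  have h3 := dist_triangle_max x₀ x a
  have h4 := dist_triangle_max y₀ y b
  rw [dist_comm x x₀] at h1
  rw [dist_comm y y₀, hy₀, hb] at h2
  rw [hy₀, hb] at h4
  rcases le_or_gt (dist x₀ a) (dist x₀ x) with h | h
  · rw [max_eq_left h] at h1 h2
    linarith
  · rw [max_eq_right h.le] at h1 h2
    rcases le_max_iff.1 h3 with h5 | h5 <;> rcases le_max_iff.1 h4 with h6 | h6 <;> linarith

/-- If a relation has the one-point extension property, then every finite partial isometry
included in it extends to an isometry included in it. -/
theorem exists_isometry_extension [Countable X] (R : X → Y → Prop)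
    (hR : ∀ x₀ y₀, R x₀ y₀ → ∀ x, 0 < dist x₀ x → ∀ F : Set Y, F.Finite →
      ∃ y, R x y ∧ dist y₀ y = dist x₀ x ∧ ∀ z ∈ F, dist x₀ x ≤ dist y z)
    {A : Set X} (hA : A.Finite) (hne : A.Nonempty) (f : X → Y)
    (hf : ∀ x ∈ A, ∀ y ∈ A, dist (f x) (f y) = dist x y) (hfR : ∀ x ∈ A, R x (f x)) :
    ∃ g : X → Y, Isometry g ∧ (∀ x, R x (g x)) ∧ ∀ x ∈ A, g x = f x := by
  classical
  let S := {p : Set X × (X → Y) // p.1.Finite ∧ p.1.Nonempty ∧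
    (∀ x ∈ p.1, ∀ y ∈ p.1, dist (p.2 x) (p.2 y) = dist x y) ∧ ∀ x ∈ p.1, R x (p.2 x)}
  have step : ∀ (s : S) (x : X), ∃ s' : S, s.1.1 ⊆ s'.1.1 ∧
      (∀ a ∈ s.1.1, s'.1.2 a = s.1.2 a) ∧ x ∈ s'.1.1 := by
    rintro ⟨⟨B, h⟩, hB, hBne, hh, hhR⟩ x
    by_cases hx : x ∈ B
    · exact ⟨⟨(B, h), hB, hBne, hh, hhR⟩, subset_rfl, fun _ _ => rfl, hx⟩
    simp only at hB hBne hh hhR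
    -- Branching from the image of a nearest point suffices: the other distances are forced.
    obtain ⟨x₀, hx₀, hmin⟩ := Set.exists_min_image B (fun a => dist a x) hB hBne
    have hpos : 0 < dist x₀ x := dist_pos.2 (ne_of_mem_of_not_mem hx₀ hx)
    obtain ⟨y, hy, hy₀, hyF⟩ := hR x₀ (h x₀) (hhR x₀ hx₀) x hpos (h '' B) (hB.image h)
    have key : ∀ a ∈ B, dist y (h a) = dist x a := fun a ha =>
      dist_eq_of_nearest (hmin a ha) (hh x₀ hx₀ a ha) hy₀ (hyF _ ⟨a, ha, rfl⟩)
    have hu : ∀ a ∈ B, Function.update h x y a = h a := fun a ha =>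
      Function.update_of_ne (ne_of_mem_of_not_mem ha hx) _ _
    refine ⟨⟨(insert x B, Function.update h x y), hB.insert x, Set.insert_nonempty _ _, ?_, ?_⟩,
      Set.subset_insert _ _, hu, Set.mem_insert _ _⟩
    · rintro a (rfl | ha) b (rfl | hb)
      · simp
      · simp only [Function.update_self, hu b hb]; exact key b hb
      · simp only [Function.update_self, hu a ha]
        rw [dist_comm, key a ha, dist_comm]
      · simp only [hu a ha, hu b hb]; exact hh a ha b hb
    · rintro a (rfl | ha)
      · simpa using hy
      · simp only [hu a ha]; exact hhR a ha
  choose next hsub heq hmem using step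
  have : Nonempty X := ⟨hne.choose⟩
  obtain ⟨e, he⟩ := exists_surjective_nat X
  choose k hk using he
  let seq : ℕ → S := fun n => Nat.rec ⟨(A, f), hA, hne, hf, hfR⟩ (fun n s => next s (e n)) n
  have mono : ∀ m n, m ≤ n → (seq m).1.1 ⊆ (seq n).1.1 ∧
      ∀ a ∈ (seq m).1.1, (seq n).1.2 a = (seq m).1.2 a := by
    intro m n hmn
    induction n, hmn using Nat.le_induction with
    | base => exact ⟨subset_rfl, fun _ _ => rfl⟩
    | succ n _ ih =>
      exact ⟨ih.1.trans (hsub _ _), fun a ha => (heq _ _ a (ih.1 ha)).trans (ih.2 a ha)⟩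
  have hin : ∀ x n, k x < n → x ∈ (seq n).1.1 := fun x n hn =>
    (mono (k x + 1) n hn).1 (by
      have h : seq (k x + 1) = next (seq (k x)) (e (k x)) := rfl
      rw [h, hk]
      exact hmem _ _)
  -- The point with index `k x` is added in passing from stage `k x` to stage `k x + 1`, and later
  -- stages do not change its image.
  let g : X → Y := fun x => (seq (k x + 1)).1.2 x
  have hg : ∀ x n, k x < n → g x = (seq n).1.2 x := fun x n hn =>
    ((mono (k x + 1) n hn).2 x (hin x _ (Nat.lt_succ_self _))).symm
  refine ⟨g, Isometry.of_dist_eq fun x y => ?_, fun x => ?_, fun x hx => ?_⟩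
  · have hx : k x < max (k x) (k y) + 1 := by omega
    have hy : k y < max (k x) (k y) + 1 := by omega
    rw [hg x _ hx, hg y _ hy]
    exact (seq _).2.2.2.1 x (hin x _ hx) y (hin y _ hy)
  · exact (seq _).2.2.2.2 x (hin x _ (Nat.lt_succ_self _))
  · exact (mono 0 (k x + 1) (Nat.zero_le _)).2 x hx

end Extension

/-! ### Ample spaces and spec-endogeneity -/

theorem exists_max_of_wellFoundedOn_gt {S T : Set ℝ} (h : S.WellFoundedOn (· > ·)) (hTS : T ⊆ S)
    (hT : T.Nonempty) : ∃ t ∈ T, ∀ s ∈ T, s ≤ t := by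
  obtain ⟨t, ht⟩ := hT
  obtain ⟨⟨m, hm⟩, hmT, hmin⟩ := WellFounded.has_min h {x : S | (x : ℝ) ∈ T} ⟨⟨t, hTS ht⟩, ht⟩
  exact ⟨m, hmT, fun s hs => not_lt.1 (hmin ⟨s, hTS hs⟩ hs)⟩

/-- A countable metric space is ample if its spectra are dually well ordered and directed, and if
each point can be moved at any positive distance `r` of its spectrum, away from finitely many
points, in such a way that the new spectrum below `r` is as large as any given spectrum. -/
structure Ample (X : Type*) [MetricSpace X] : Prop where
  countable : Countable X
  wellFounded : ∀ x : X, (spec x).WellFoundedOn (· > ·)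
  directed : ∀ x y : X, ∃ z : X, spec x ⊆ spec z ∧ spec y ⊆ spec z
  branching : ∀ y c : X, ∀ r ∈ spec y, 0 < r → ∀ F : Set X, F.Finite →
    ∃ y' : X, dist y y' = r ∧ (∀ z ∈ F, r ≤ dist y' z) ∧ ∀ t ∈ spec c, t < r → t ∈ spec y'

namespace Ample

variable {X : Type*} [MetricSpace X] [IsUltrametricDist X]

theorem specEndogeneous (hX : Ample X) : SpecEndogeneous X := by
  intro A f hA hf hspec
  have := hX.countable
  rcases A.eq_empty_or_nonempty with rfl | hne
  · exact ⟨id, isometry_id, by simp⟩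
  suffices h : _ by
    obtain ⟨g, hg, -, hgf⟩ := exists_isometry_extension (fun x y : X => spec x ⊆ spec y) h hA hne f
      hf hspec
    exact ⟨g, hg, hgf⟩
  intro x₀ y₀ h x hpos F hF
  have hr : dist x₀ x ∈ spec y₀ := h ⟨x, rfl⟩
  obtain ⟨y, hy, hyF, hys⟩ := hX.branching y₀ x _ hr hpos F hF
  refine ⟨y, fun t ht => ?_, hy, hyF⟩
  -- Below the branching distance the spectrum comes from branching; from that distance on, `x`
  -- agrees with `x₀` and `y` with `y₀`.
  rcases lt_or_ge t (dist x₀ x) with hlt | hle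
  · exact hys t ht hlt
  · exact spec_subset_of_dist_le (hy.le.trans hle)
      (h (spec_subset_of_dist_le (by rwa [dist_comm]) ht))

/-! ### Indivisibility of ample spaces -/

/-- The set `B` contains no copy of `N` inside `N`. -/
def NoCopy (B N : Set X) : Prop :=
  ¬ ∃ g : X → X, (∀ u ∈ N, ∀ v ∈ N, dist (g u) (g v) = dist u v) ∧ ∀ u ∈ N, g u ∈ N ∩ B

/-- If this fails, every candidate `y` is the centre of a smaller ball that has a copy of itself in
`B`. The largest such balls with radii in `spec x` are equal or disjoint. Embedding the ball around
`y₀` into the set of candidates and then applying these copies ball by ball gives a copy of it in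
`B`. The clause on `F` lets the lemma serve as a one-point extension step. -/
theorem exists_noCopy_chain (hX : Ample X) {B : Set X} {y₀ : X} {r : ℝ} (hr : r ∈ spec y₀)
    (hpos : 0 < r) (hB : NoCopy B (Metric.closedBall y₀ r)) (x : X) {F : Set X} (hF : F.Finite) :
    ∃ y, dist y₀ y = r ∧ (∀ z ∈ F, r ≤ dist y z) ∧
      ∀ t ∈ spec x, t < r → t ∈ spec y ∧ NoCopy B (Metric.closedBall y t) := by
  have := hX.countable
  by_contra hcon
  let Y : Set X := {y | dist y₀ y = r ∧ (∀ z ∈ F, r ≤ dist y z) ∧ ∀ t ∈ spec x, t < r → t ∈ spec y}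
  have hY : ∀ y ∈ Y, ∃ t ∈ spec x, t < r ∧ ¬ NoCopy B (Metric.closedBall y t) := by
    rintro y ⟨h1, h2, h3⟩
    by_contra hno
    exact hcon ⟨y, h1, h2, fun t ht htr => ⟨h3 t ht htr, by
      by_contra h; exact hno ⟨t, ht, htr, h⟩⟩⟩
  have hmax : ∀ y : X, ∃ t : ℝ, y ∈ Y → (t ∈ spec x ∧ t < r ∧
      ¬ NoCopy B (Metric.closedBall y t)) ∧
      ∀ s ∈ spec x, s < r → ¬ NoCopy B (Metric.closedBall y s) → s ≤ t := by
    intro y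
    by_cases hy : y ∈ Y
    · obtain ⟨t, ht, hmax⟩ := exists_max_of_wellFoundedOn_gt (hX.wellFounded x)
        (T := {t | t ∈ spec x ∧ t < r ∧ ¬ NoCopy B (Metric.closedBall y t)}) (fun t h => h.1)
        (hY y hy)
      exact ⟨t, fun _ => ⟨ht, fun s h1 h2 h3 => hmax s ⟨h1, h2, h3⟩⟩⟩
    · exact ⟨0, fun h => absurd h hy⟩
  choose τ hτ using hmax
  have hcopy : ∀ Q : Set X, ∃ g : X → X, ¬ NoCopy B Q →
      (∀ u ∈ Q, ∀ v ∈ Q, dist (g u) (g v) = dist u v) ∧ ∀ u ∈ Q, g u ∈ Q ∩ B := by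
    intro Q
    by_cases hQ : NoCopy B Q
    · exact ⟨id, fun h => absurd hQ h⟩
    · obtain ⟨g, hg⟩ := not_not.1 hQ
      exact ⟨g, fun _ => hg⟩
  -- The copy depends on the ball as a set and not on its centre, so points of the same ball are
  -- moved by the same map.
  choose G hG using hcopy
  obtain ⟨c, hc₀, hcx⟩ := hX.directed y₀ x
  obtain ⟨y₁, hy₁, hy₁F, hy₁s⟩ := hX.branching y₀ c r hr hpos F hF
  suffices hext : _ by
    obtain ⟨φ, hφ, hφR, -⟩ := exists_isometry_extension (X := Metric.closedBall y₀ r) (Y := X)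
      (fun z y => y ∈ Y ∧ ∀ t ∈ spec (z : X), t < r → t ∈ spec y) hext
      (A := {⟨y₀, Metric.mem_closedBall_self hpos.le⟩}) (Set.finite_singleton _)
      (Set.singleton_nonempty _) (fun _ => y₁) (by simp)
      (by
        rintro _ rfl
        exact ⟨⟨hy₁, hy₁F, fun t ht => hy₁s t (hcx ht)⟩, fun t ht => hy₁s t (hc₀ ht)⟩)
    -- By maximality of `τ`, two of the chosen balls that meet have the same radius.
    have hball : ∀ z z', τ (φ z') ≤ τ (φ z) → dist (φ z) (φ z') ≤ τ (φ z) →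
        Metric.closedBall (φ z) (τ (φ z)) = Metric.closedBall (φ z') (τ (φ z')) := by
      intro z z' hle hd
      obtain ⟨⟨h1, h2, h3⟩, -⟩ := hτ _ (hφR z).1
      have hb : Metric.closedBall (φ z) (τ (φ z)) = Metric.closedBall (φ z') (τ (φ z)) :=
        closedBall_eq_of_mem (by rwa [Metric.mem_closedBall, dist_comm])
      have h4 := (hτ _ (hφR z').1).2 _ h1 h2 (hb ▸ h3)
      rw [hb, le_antisymm hle h4]
    have hself : ∀ z, φ z ∈ Metric.closedBall (φ z) (τ (φ z)) := fun z =>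
      Metric.mem_closedBall_self (by
        obtain ⟨w, hw⟩ := (hτ _ (hφR z).1).1.1
        rw [← hw]; exact dist_nonneg)
    have hψ : ∀ z, G (Metric.closedBall (φ z) (τ (φ z))) (φ z) ∈
        Metric.closedBall (φ z) (τ (φ z)) ∩ B := fun z =>
      (hG _ (hτ _ (hφR z).1).1.2.2).2 _ (hself z)
    let ψ : Metric.closedBall y₀ r → X := fun z => G (Metric.closedBall (φ z) (τ (φ z))) (φ z)
    have hdist : ∀ z z', τ (φ z') ≤ τ (φ z) → dist (ψ z) (ψ z') = dist z z' := by
      intro z z' hle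
      rw [← hφ.dist_eq z z']
      -- Either both points lie in one ball, which is moved isometrically, or their distance exceeds
      -- both radii and moving each point inside its ball does not affect it.
      rcases le_or_gt (dist (φ z) (φ z')) (τ (φ z)) with hd | hd
      · have hb := hball z z' hle hd
        have h := (hG _ (hτ _ (hφR z).1).1.2.2).1 (φ z) (hself z) (φ z') (hb ▸ hself z')
        simp only [ψ]
        rw [← hb]; exact h
      · have h1 : dist (ψ z) (φ z) ≤ τ (φ z) := (hψ z).1
        have h2 : dist (ψ z') (φ z') ≤ τ (φ z') := (hψ z').1
        apply le_antisymm
        · refine (dist_triangle_max (ψ z) (φ z) (ψ z')).trans (max_le (by linarith) ?_)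
          refine (dist_triangle_max (φ z) (φ z') (ψ z')).trans (max_le le_rfl ?_)
          rw [dist_comm]; linarith
        · have h3 := dist_triangle_max (φ z) (ψ z) (φ z')
          have h4 := dist_triangle_max (ψ z) (ψ z') (φ z')
          rw [dist_comm (φ z) (ψ z)] at h3
          rcases le_max_iff.1 h3 with h5 | h5
          · linarith
          rcases le_max_iff.1 h4 with h6 | h6 <;> linarith
    classical
    refine hB ⟨fun u => if h : u ∈ Metric.closedBall y₀ r then ψ ⟨u, h⟩ else u, ?_, ?_⟩
    · intro u hu v hv
      simp only [dif_pos hu, dif_pos hv]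
      rcases le_total (τ (φ ⟨u, hu⟩)) (τ (φ ⟨v, hv⟩)) with h | h
      · rw [dist_comm, hdist _ _ h, dist_comm]; rfl
      · exact hdist _ _ h
    · intro u hu
      simp only [dif_pos hu]
      have h := hψ ⟨u, hu⟩
      refine ⟨?_, h.2⟩
      have h1 := h.1
      rw [Metric.mem_closedBall] at h1
      have h2 := (hτ _ (hφR ⟨u, hu⟩).1).1.2.1
      have h3 := (hφR ⟨u, hu⟩).1.1
      rw [dist_comm] at h3
      exact (dist_triangle_max _ (φ ⟨u, hu⟩) _).trans (max_le (h1.trans h2.le) h3.le)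
  rintro z₀ y ⟨⟨hy1, hy2, hy3⟩, hyz⟩ z hρ F' hF'
  -- The new point needs `spec x` below `r` to remain a candidate, and `spec z` below `r` to
  -- continue the construction.
  obtain ⟨c, hcz, hcx⟩ := hX.directed (z : X) x
  have hρr : dist z₀ z ≤ r := by
    refine (dist_triangle_max (z₀ : X) y₀ z).trans (max_le z₀.2 ?_)
    rw [dist_comm]; exact z.2
  have hρz : dist z₀ z ∈ spec (z₀ : X) := ⟨z, rfl⟩
  have hρy : dist z₀ z ∈ spec y := by
    rcases hρr.lt_or_eq with h | h
    · exact hyz _ hρz h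
    · exact ⟨y₀, by simp only; rw [dist_comm, hy1, h]⟩
  -- Avoiding `y₀` and `F` matters only when the branching distance is `r`; at smaller distances
  -- `y'` inherits its distance from them from `y`.
  obtain ⟨y', hy', hy'F, hy's⟩ := hX.branching y c _ hρy hρ (F' ∪ insert y₀ F)
    (hF'.union (hF.insert y₀))
  have hfar : ∀ z' ∈ insert y₀ F, r ≤ dist y z' → r ≤ dist y' z' := by
    intro z' hz' h
    rcases hρr.lt_or_eq with h' | h'
    · rcases le_max_iff.1 (dist_triangle_max y y' z') with h5 | h5 <;> linarith
    · rw [← h']; exact hy'F _ (Or.inr hz')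
  refine ⟨y', ⟨⟨?_, ?_, ?_⟩, ?_⟩, hy', fun z' hz' => hy'F z' (Or.inl hz')⟩
  · apply le_antisymm
    · exact (dist_triangle_max y₀ y y').trans (max_le hy1.le (hy'.le.trans hρr))
    · rw [dist_comm]
      exact hfar _ (Set.mem_insert _ _) (by rw [dist_comm, hy1])
  · exact fun z' hz' => hfar _ (Or.inr hz') (hy2 z' hz')
  · intro t ht htr
    rcases lt_or_ge t (dist z₀ z) with hlt | hle
    · exact hy's t (hcx ht) hlt
    · exact spec_subset_of_dist_le (hy'.le.trans hle) (hy3 t ht htr)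
  · intro t ht htr
    rcases lt_or_ge t (dist z₀ z) with hlt | hle
    · exact hy's t (hcz ht) hlt
    · refine spec_subset_of_dist_le (hy'.le.trans hle) (hyz t ?_ htr)
      refine spec_subset_of_dist_le (x := (z : X)) ?_ ht
      rw [dist_comm]; exact hle

/-- The spectrum of a point has a maximum, so the space is a closed ball and the absence of copies
in `Aᶜ` can be propagated to all radii around the image points. -/
theorem indivisible (hX : Ample X) : Indivisible X := by
  intro A
  have := hX.countable
  by_cases hcopy : ∃ f : X → X, Isometry f ∧ ∀ x, f x ∈ Aᶜ
  · exact Or.inr hcopy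
  refine Or.inl ?_
  rcases isEmpty_or_nonempty X with hE | ⟨⟨a⟩⟩
  · exact ⟨id, isometry_id, fun x => hE.elim x⟩
  obtain ⟨r, hr, hmax⟩ := exists_max_of_wellFoundedOn_gt (hX.wellFounded a) subset_rfl
    ⟨0, zero_mem_spec a⟩
  have huniv : Metric.closedBall a r = Set.univ :=
    Set.eq_univ_of_forall fun x => by
      rw [Metric.mem_closedBall, dist_comm]; exact hmax _ ⟨x, rfl⟩
  have hN : NoCopy Aᶜ (Metric.closedBall a r) := by
    rintro ⟨g, hg, hgA⟩
    rw [huniv] at hg hgA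
    exact hcopy ⟨g, Isometry.of_dist_eq fun x y => hg x trivial y trivial,
      fun x => (hgA x trivial).2⟩
  have start : ∃ y, ∀ t ∈ spec a, t ∈ spec y ∧ NoCopy Aᶜ (Metric.closedBall y t) := by
    rcases (hmax 0 (zero_mem_spec a)).eq_or_lt with h0 | hpos
    · refine ⟨a, fun t ht => ⟨ht, ?_⟩⟩
      have : t = r := le_antisymm (hmax t ht) (by
        obtain ⟨w, hw⟩ := ht
        rw [← h0, ← hw]; exact dist_nonneg)
      rwa [this]
    · obtain ⟨y, hy, -, hyt⟩ := exists_noCopy_chain hX hr hpos hN a Set.finite_empty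
      refine ⟨y, fun t ht => ?_⟩
      rcases (hmax t ht).lt_or_eq with h | h
      · exact hyt t ht h
      · subst h
        refine ⟨spec_subset_of_dist_le hy.le ht, ?_⟩
        rw [← closedBall_eq_of_mem (x := a) (by rw [Metric.mem_closedBall, dist_comm, hy])]
        exact hN
  obtain ⟨b, hb⟩ := start
  suffices hext : _ by
    obtain ⟨g, hg, hgR, -⟩ := exists_isometry_extension
      (fun x y : X => ∀ t ∈ spec x, t ∈ spec y ∧ NoCopy Aᶜ (Metric.closedBall y t)) hext
      (Set.finite_singleton a) (Set.singleton_nonempty a) (fun _ => b) (by simp)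
      (by rintro _ rfl; exact hb)
    refine ⟨g, hg, fun x => ?_⟩
    by_contra hx
    have h := (hgR x 0 (zero_mem_spec x)).2
    -- A singleton has no copy of itself in `Aᶜ` only if its point is in `A`.
    rw [Metric.closedBall_zero] at h
    exact h ⟨id, fun _ _ _ _ => rfl, by rintro _ rfl; exact ⟨rfl, hx⟩⟩
  intro x₀ y₀ h x hpos F hF
  obtain ⟨hr, hN⟩ := h _ ⟨x, rfl⟩
  obtain ⟨y, hy, hyF, hyt⟩ := exists_noCopy_chain hX hr hpos hN x hF
  refine ⟨y, fun t ht => ?_, hy, hyF⟩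
  rcases lt_or_ge t (dist x₀ x) with hlt | hle
  · exact hyt t ht hlt
  · obtain ⟨h1, h2⟩ := h t (spec_subset_of_dist_le (by rwa [dist_comm]) ht)
    have hd : dist y₀ y ≤ t := hy.le.trans hle
    refine ⟨spec_subset_of_dist_le hd h1, ?_⟩
    rwa [← closedBall_eq_of_mem (x := y₀) (by rwa [Metric.mem_closedBall, dist_comm])]

/-! ### Balls of ample spaces -/

theorem spec_coe_subset {Z : Type*} [MetricSpace Z] {s : Set Z} (x : s) : spec x ⊆ spec (x : Z) := by
  rintro _ ⟨z, rfl⟩; exact ⟨z, rfl⟩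

/-- The closed ball with an attained radius is ample. -/
theorem closedBall (hX : Ample X) {a : X} {r : ℝ} (hr : r ∈ spec a) :
    Ample (Metric.closedBall a r) := by
  have := hX.countable
  have hle : ∀ x : Metric.closedBall a r, ∀ t ∈ spec x, t ≤ r := by
    rintro x _ ⟨z, rfl⟩
    refine (dist_triangle_max (x : X) a z).trans (max_le x.2 ?_)
    rw [dist_comm]; exact z.2
  have hmem : ∀ (x : Metric.closedBall a r) t, t ∈ spec (x : X) → t ≤ r → t ∈ spec x := by
    rintro x _ ⟨z, rfl⟩ ht
    refine ⟨⟨z, ?_⟩, rfl⟩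
    simp only at ht
    rw [dist_comm] at ht
    exact (dist_triangle_max z (x : X) a).trans (max_le ht x.2)
  refine ⟨inferInstance, fun x => (hX.wellFounded x).subset (spec_coe_subset x), ?_, ?_⟩
  · intro x y
    obtain ⟨c, hcx, hcy⟩ := hX.directed (x : X) y
    have hr0 : 0 ≤ r := by
      obtain ⟨w, hw⟩ := hr
      rw [← hw]; exact dist_nonneg
    rcases hr0.eq_or_lt with h0 | hpos
    · have h : ∀ w : Metric.closedBall a r, (w : X) = a := fun w =>
        dist_le_zero.1 (by simpa [← h0] using w.2)
      have hxy : x = y := Subtype.ext ((h x).trans (h y).symm)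
      exact ⟨x, subset_rfl, hxy ▸ subset_rfl⟩
    -- The upper bound `c` may lie outside the ball; branching from `a` brings its spectrum below
    -- `r` back into the ball.
    obtain ⟨z, hz, -, hzs⟩ := hX.branching a c r hr hpos ∅ Set.finite_empty
    have hza : z ∈ Metric.closedBall a r := by rw [Metric.mem_closedBall, dist_comm, hz]
    have key : ∀ w : Metric.closedBall a r, spec (w : X) ⊆ spec c →
        spec w ⊆ spec (⟨z, hza⟩ : Metric.closedBall a r) := by
      intro w hw t ht
      refine hmem _ t ?_ (hle w t ht)
      rcases (hle w t ht).lt_or_eq with h | rfl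
      · exact hzs t (hw (spec_coe_subset w ht)) h
      · exact spec_subset_of_dist_le hz.le hr
    exact ⟨⟨z, hza⟩, key x hcx, key y hcy⟩
  · intro y c s hs hpos F hF
    obtain ⟨y', h1, h2, h3⟩ := hX.branching (y : X) c s (spec_coe_subset y hs) hpos
      (Subtype.val '' F) (hF.image _)
    have hsr := hle y s hs
    have hy' : y' ∈ Metric.closedBall a r := by
      refine (dist_triangle_max y' (y : X) a).trans (max_le ?_ y.2)
      rw [dist_comm, h1]; exact hsr
    exact ⟨⟨y', hy'⟩, h1, fun z hz => h2 z ⟨z, hz, rfl⟩, fun t ht hts =>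
      hmem _ t (h3 t (spec_coe_subset c ht) hts) (hts.le.trans hsr)⟩

theorem indivisible_of_isEmpty {Z : Type*} [MetricSpace Z] [IsEmpty Z] : Indivisible Z :=
  fun _ => Or.inl ⟨id, isometry_id, fun x => isEmptyElim x⟩

theorem hereditarilyIndivisible (hX : Ample X) : HereditarilyIndivisible X := by
  -- Open and closed balls are treated together: `T` is an initial segment of distances, and the
  -- largest distance from `a` in `T` is an attained closed radius.
  have key : ∀ (N : Set X) (a : X) (T : Set ℝ),
      (∀ x, x ∈ N ↔ dist a x ∈ T) → (0 : ℝ) ∈ T → (∀ s ∈ T, ∀ t, 0 ≤ t → t ≤ s → t ∈ T) →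
      Indivisible N := by
    intro N a T hN h0 hlow
    obtain ⟨r, ⟨hr, hrT⟩, hmax⟩ := exists_max_of_wellFoundedOn_gt (hX.wellFounded a)
      (T := spec a ∩ T) Set.inter_subset_left ⟨0, zero_mem_spec a, h0⟩
    have : N = Metric.closedBall a r := by
      ext x
      rw [hN, Metric.mem_closedBall, dist_comm x a]
      exact ⟨fun h => hmax _ ⟨⟨x, rfl⟩, h⟩, fun h => hlow r hrT _ dist_nonneg h⟩
    subst this
    exact (hX.closedBall hr).indivisible
  refine ⟨hX.indivisible, fun a r => ⟨?_, ?_⟩⟩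
  · rcases le_or_gt r 0 with h | h
    · have : IsEmpty (Metric.ball a r) := by
        rw [Metric.ball_eq_empty.2 h]; infer_instance
      exact indivisible_of_isEmpty
    · exact key _ a (Set.Iio r) (fun x => by rw [Metric.mem_ball, dist_comm]; rfl) h
        fun s hs t _ hts => hts.trans_lt hs
  · rcases lt_or_ge r 0 with h | h
    · have : IsEmpty (Metric.closedBall a r) := by
        rw [Metric.closedBall_eq_empty.2 h]; infer_instance
      exact indivisible_of_isEmpty
    · exact key _ a (Set.Iic r) (fun x => by rw [Metric.mem_closedBall, dist_comm]; rfl) h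
        fun s hs t _ hts => hts.trans hs

end Ample

end PathExtension
namespace PathExtension

/-! ### Paths, their spectra and switching -/

section Paths

variable {M : Type*} [MetricSpace M]

theorem diam_closedBall_of_mem_spec [IsUltrametricDist M] {a : M} {r : ℝ} (hr : r ∈ spec a) :
    Metric.diam (Metric.closedBall a r) = r := by
  obtain ⟨x, rfl⟩ := hr
  simp only
  refine le_antisymm (Metric.diam_le_of_forall_dist_le dist_nonneg fun y hy z hz => ?_) ?_
  · refine (IsUltrametricDist.dist_triangle_max y a z).trans (max_le hy ?_)
    rw [dist_comm]; exact hz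
  · refine Metric.dist_le_diam_of_mem Metric.isBounded_closedBall
      (Metric.mem_closedBall_self dist_nonneg) ?_
    rw [Metric.mem_closedBall, dist_comm]

theorem closedBall_mem_nerve {a : M} {r : ℝ} (hr : r ∈ spec a) :
    Metric.closedBall a r ∈ nerve M := ⟨a, r, hr, rfl⟩

theorem mem_closedBall_of_mem_spec {a : M} {r : ℝ} (hr : r ∈ spec a) :
    a ∈ Metric.closedBall a r :=
  Metric.mem_closedBall_self (by obtain ⟨x, rfl⟩ := hr; exact dist_nonneg)

theorem diam_mem_spec [IsUltrametricDist M] {B : Set M} (hB : B ∈ nerve M) {b : M} (hb : b ∈ B) :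
    Metric.diam B ∈ spec b := by
  obtain ⟨x, -, hx⟩ := (nerve_attained hB hb).2
  exact ⟨x, hx⟩

/-- An attained radius is the diameter of its ball, so increasing radii around `a` give strictly
increasing balls of the nerve. -/
theorem spec_wellFoundedOn_of_nerve [IsUltrametricDist M]
    (hwf : (nerve M).WellFoundedOn (fun B C => C ⊂ B)) (a : M) :
    (spec a).WellFoundedOn (· > ·) := by
  let φ : spec a → nerve M := fun r => ⟨Metric.closedBall a r, closedBall_mem_nerve r.2⟩
  refine Subrelation.wf (r := InvImage (fun B C : nerve M => (C : Set M) ⊂ B) φ) ?_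
    (InvImage.wf φ hwf)
  intro s t hst
  have hst : (t : ℝ) < s := hst
  refine ⟨Metric.closedBall_subset_closedBall hst.le, fun h => ?_⟩
  have := Metric.diam_mono h Metric.isBounded_closedBall
  rw [diam_closedBall_of_mem_spec s.2, diam_closedBall_of_mem_spec t.2] at this
  linarith

theorem countable_nerve [Countable M] : (nerve M).Countable := by
  refine (Set.countable_range fun p : M × M => Metric.closedBall p.1 (dist p.1 p.2)).mono ?_
  rintro _ ⟨a, _, ⟨x, rfl⟩, rfl⟩
  exact ⟨(a, x), rfl⟩

instance [Countable M] : Countable (PathExt M) := by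
  have h : {I : Set (Set M) | IsPath I}.Countable := by
    refine ((Set.countable_ofPred_finite_subset (countable_nerve (M := M))).image gen).mono ?_
    rintro _ ⟨𝓑, hfin, -, hsub, -, rfl⟩
    exact ⟨𝓑, ⟨hfin, hsub⟩, rfl⟩
  have : Countable (BallPath M) := h.to_subtype
  exact Subtype.countable

theorem delta_nonneg (I : BallPath M) : 0 ≤ delta I := by
  obtain ⟨B, -, hB⟩ := (delta_isLeast I).1
  rw [← hB]; exact Metric.diam_nonneg

/-- Pairwise disjoint balls meet a path in a finite set. -/
theorem finite_setOf_mem_path {I : Set (Set M)} (hI : IsPath I) {ι : Type*} {S : Set ι}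
    {E : ι → Set M} (hE : S.PairwiseDisjoint E) : {i ∈ S | E i ∈ I}.Finite := by
  obtain ⟨𝓑, hfin, -, hsub, -, rfl⟩ := hI
  have : ∀ i, ∃ B : Set M, E i ∈ gen 𝓑 → B ∈ 𝓑 ∧ B ⊆ E i := by
    intro i
    by_cases h : E i ∈ gen 𝓑
    · obtain ⟨B, hB, hBE, -⟩ := h.2
      exact ⟨B, fun _ => ⟨hB, hBE⟩⟩
    · exact ⟨∅, fun h' => absurd h' h⟩
  choose p hp using this
  refine Set.Finite.of_finite_image (f := p) (hfin.subset ?_) ?_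
  · rintro _ ⟨i, hi, rfl⟩
    exact (hp i hi.2).1
  · intro i hi j hj hij
    by_contra hne
    obtain ⟨b, hb⟩ := nerve_nonempty (hsub (hp i hi.2).1)
    exact Set.disjoint_left.1 (hE hi.1 hj.1 hne) ((hp i hi.2).2 hb)
      ((hp j hj.2).2 (hij ▸ hb))

/-- The path that follows `I` down to diameter `r`, and then descends to the point `p`. -/
def switch (I : Set (Set M)) (r : ℝ) (p : M) : Set (Set M) :=
  (I \ {C | Metric.diam C < r}) ∪ {D ∈ nerve M | p ∈ D ∧ Metric.diam D < r}

theorem singleton_mem_nerve (p : M) : {p} ∈ nerve M :=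
  ⟨p, 0, zero_mem_spec p, Metric.closedBall_zero.symm⟩

theorem isPath_switch [IsUltrametricDist M] {I : Set (Set M)} (hI : IsPath I) {C : Set M}
    (hC : C ∈ I) (hpos : 0 < Metric.diam C) (p : M) : IsPath (switch I (Metric.diam C) p) := by
  obtain ⟨𝓑, hfin, hne, hsub, hinj, hgen⟩ := isPath_segment hI hC
  have hge : ∀ B ∈ 𝓑, Metric.diam C ≤ Metric.diam B := fun B hB => by
    have : B ∈ gen 𝓑 := ⟨hsub hB, B, hB, subset_rfl, fun _ _ h => h⟩
    rw [← hgen] at this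
    exact not_lt.1 this.2
  -- This generator stops the balls generated by `{p}` strictly below the diameter of `C`.
  have hle : ∃ B ∈ 𝓑, Metric.diam B = Metric.diam C := by
    have : C ∈ gen 𝓑 := by rw [← hgen]; exact ⟨hC, by simp⟩
    obtain ⟨hCn, B, hB, hBC, -⟩ := this
    exact ⟨B, hB, le_antisymm (Metric.diam_mono hBC (nerve_bounded hCn)) (hge B hB)⟩
  have hp : Metric.diam ({p} : Set M) = 0 := Metric.diam_singleton
  refine ⟨insert {p} 𝓑, hfin.insert _, Set.insert_nonempty _ _, ?_, ?_, ?_⟩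
  · rintro B (rfl | hB)
    · exact singleton_mem_nerve p
    · exact hsub hB
  · rintro B (rfl | hB) D (rfl | hD) h
    · rfl
    · have := hge D hD; linarith
    · have := hge B hB; linarith
    · exact hinj hB hD h
  · rw [switch, hgen]
    ext D
    constructor
    · rintro (⟨hDn, B, hB, hBD, hlt⟩ | ⟨hDn, hpD, hDr⟩)
      · refine ⟨hDn, B, Or.inr hB, hBD, ?_⟩
        rintro B' (rfl | hB') h
        · have := hge B hB; linarith
        · exact hlt B' hB' h
      · refine ⟨hDn, {p}, Or.inl rfl, Set.singleton_subset_iff.2 hpD, ?_⟩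
        rintro B' (rfl | hB') h
        · exact absurd h (lt_irrefl _)
        · exact hDr.trans_le (hge B' hB')
    · rintro ⟨hDn, B, rfl | hB, hBD, hlt⟩
      · obtain ⟨B', hB', hB'C⟩ := hle
        refine Or.inr ⟨hDn, hBD rfl, ?_⟩
        rw [← hB'C]
        exact hlt B' (Or.inr hB') (by rw [hp, hB'C]; exact hpos)
      · exact Or.inl ⟨hDn, B, hB, hBD, fun B' hB' => hlt B' (Or.inr hB')⟩

theorem delta_eq_zero_of_singleton_mem {I : BallPath M} {p : M} (h : {p} ∈ I.1) : delta I = 0 :=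
  le_antisymm ((delta_isLeast I).2 ⟨{p}, h, Metric.diam_singleton⟩) (delta_nonneg I)

variable [IsUltrametricDist M]

/-- The element of the path extension that follows `I` down to the ball `C`, and then descends to
the point `p`. -/
def switchPath (I : PathExt M) {C : Set M} (hC : C ∈ I.1.1) (hpos : 0 < Metric.diam C) (p : M) :
    PathExt M :=
  ⟨⟨switch I.1.1 (Metric.diam C) p, isPath_switch I.1.2 hC hpos p⟩,
    delta_eq_zero_of_singleton_mem (p := p)
      (Or.inr ⟨singleton_mem_nerve p, rfl, by rwa [Metric.diam_singleton]⟩)⟩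

theorem meet_le_left (I J : BallPath M) : meet I J ≤ I := (isGLB_meet I J).1 (by simp)

theorem meet_le_right (I J : BallPath M) : meet I J ≤ J := (isGLB_meet I J).1 (by simp)

theorem dist_switchPath_le (I : PathExt M) {C : Set M} (hC : C ∈ I.1.1)
    (hpos : 0 < Metric.diam C) (p : M) :
    dist I (switchPath I hC hpos p) ≤ Metric.diam C := by
  let K : BallPath M := ⟨_, isPath_segment I.1.2 hC⟩
  have hKC : C ∈ K.1 := ⟨hC, by simp⟩
  have hK : K ≤ meet I.1 (switchPath I hC hpos p).1 := by
    refine (isGLB_meet _ _).2 ?_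
    rintro _ (rfl | rfl)
    · exact ⟨_, ⟨C, hC, rfl⟩, rfl⟩
    · refine ⟨Metric.diam C, ⟨C, Or.inl hKC, rfl⟩, ?_⟩
      ext D
      constructor
      · exact fun h => ⟨Or.inl h, h.2⟩
      · rintro ⟨h | h, hD⟩
        · exact h
        · exact absurd h.2.2 hD
  exact (delta_anti hK).trans ((delta_isLeast K).2 ⟨C, hKC, rfl⟩)

/-- Two elements of the path extension at distance less than `r` share the largest ball of
diameter less than `r` of any of them. -/
theorem mem_of_dist_lt {I J : PathExt M} {E : Set M} {r : ℝ} (hE : E ∈ I.1.1)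
    (hmax : ∀ D ∈ I.1.1, Metric.diam D < r → Metric.diam D ≤ Metric.diam E)
    (h : dist I J < r) : E ∈ J.1.1 := by
  obtain ⟨⟨D, hD, hDd⟩, hI⟩ := le_iff.1 (meet_le_left I.1 J.1)
  obtain ⟨-, hJ⟩ := le_iff.1 (meet_le_right I.1 J.1)
  have hEK : E ∈ (meet I.1 J.1).1 := by
    rw [hI]
    simp only [Set.mem_sdiff, Set.mem_ofPred_eq, not_lt]
    refine ⟨hE, ?_⟩
    rw [← hDd]
    exact hmax D hD (by rw [hDd]; exact h)
  rw [hJ] at hEK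
  exact hEK.1

theorem spec_subset_diam (I : PathExt M) : spec I ⊆ Metric.diam '' I.1.1 := by
  rintro _ ⟨J, rfl⟩
  exact (le_iff.1 (meet_le_left I.1 J.1)).1

end Paths

/-! ### Ampleness of the path extension of a monoid -/

section Monoid

variable {M : Type*} [MetricSpace M] [AddMonoid M]

theorem spec_subset_spec_add_right (hright : ∀ x y z : M, dist (x + z) (y + z) = dist x y)
    (a b : M) : spec a ⊆ spec (a + b) := by
  rintro _ ⟨x, rfl⟩
  exact ⟨x + b, hright _ _ _⟩

theorem spec_subset_spec_add_left (hleft : ∀ x y z : M, dist (z + x) (z + y) = dist x y)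
    (a b : M) : spec b ⊆ spec (a + b) := by
  rintro _ ⟨x, rfl⟩
  exact ⟨a + x, hleft _ _ _⟩

/-- The diameters of the members of a path belong to the spectrum of a single point. -/
theorem exists_diam_subset_spec [IsUltrametricDist M]
    (hleft : ∀ x y z : M, dist (z + x) (z + y) = dist x y)
    (hright : ∀ x y z : M, dist (x + z) (y + z) = dist x y) {I : Set (Set M)} (hI : IsPath I) :
    ∃ m : M, Metric.diam '' I ⊆ spec m := by
  obtain ⟨𝓑, hfin, -, hsub, -, rfl⟩ := hI
  suffices h : ∃ m : M, ∀ B ∈ 𝓑, ∀ C ∈ nerve M, B ⊆ C → Metric.diam C ∈ spec m by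
    obtain ⟨m, hm⟩ := h
    refine ⟨m, ?_⟩
    rintro _ ⟨C, ⟨hC, B, hB, hBC, -⟩, rfl⟩
    exact hm B hB C hC hBC
  induction 𝓑, hfin using Set.Finite.induction_on with
  | empty => exact ⟨0, by simp⟩
  | @insert B 𝓑 _ _ ih =>
    obtain ⟨m, hm⟩ := ih ((Set.subset_insert _ _).trans hsub)
    obtain ⟨b, hb⟩ := nerve_nonempty (hsub (Set.mem_insert B 𝓑))
    refine ⟨b + m, ?_⟩
    rintro B' (rfl | hB') C hC hBC
    · exact spec_subset_spec_add_right hright b m (diam_mem_spec hC (hBC hb))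
    · exact spec_subset_spec_add_left hleft b m (hm B' hB' C hC hBC)

/-- The centres of infinitely many sons of the whole space. -/
theorem exists_infinite_separated {Z : Type*} [MetricSpace Z] [IsUltrametricDist Z]
    (hsons : (sons (Set.univ : Set Z)).Infinite) :
    ∃ S : Set Z, S.Infinite ∧ ∀ x ∈ S, ∀ y ∈ S, x ≠ y → ∀ C : Set Z, Metric.diam C ≤ dist x y := by
  obtain ⟨-, ⟨hpos, -⟩⟩ := hsons.nonempty
  -- `Metric.diam` is `0` on unbounded sets, so the existence of a son forces boundedness.
  have hbdd : Bornology.IsBounded (Set.univ : Set Z) := by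
    by_contra h
    rw [Metric.diam_eq_zero_of_unbounded h] at hpos
    exact lt_irrefl _ hpos
  have : ∀ B : Set Z, ∃ b : Z, B ∈ sons (Set.univ : Set Z) →
      B = Metric.ball b (Metric.diam (Set.univ : Set Z)) := by
    intro B
    by_cases hB : B ∈ sons (Set.univ : Set Z)
    · obtain ⟨-, b, hb, -⟩ := hB
      exact ⟨b, fun _ => hb⟩
    · obtain ⟨-, -, b, -⟩ := hsons.nonempty
      exact ⟨b, fun h => absurd h hB⟩
  choose p hp using this
  refine ⟨p '' sons Set.univ, hsons.image fun B hB C hC h => ?_, ?_⟩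
  · rw [hp B hB, hp C hC, h]
  · rintro _ ⟨B, hB, rfl⟩ _ ⟨C, hC, rfl⟩ hne D
    by_contra hlt
    have hD : Metric.diam D ≤ Metric.diam (Set.univ : Set Z) :=
      Metric.diam_mono (Set.subset_univ _) hbdd
    refine hne (congrArg p ?_)
    rw [hp B hB, hp C hC]
    refine (IsUltrametricDist.ball_eq_of_mem ?_)
    rw [Metric.mem_ball, dist_comm]
    linarith

/-- A path can be left at any of its balls of positive diameter, away from finitely many paths and
towards a path whose diameters below are as many as those of any given path. -/
theorem exists_switch [IsUltrametricDist M]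
    (hleft : ∀ x y z : M, dist (z + x) (z + y) = dist x y)
    (hright : ∀ x y z : M, dist (x + z) (y + z) = dist x y)
    (hwf : (nerve M).WellFoundedOn (fun B C => C ⊂ B))
    (hsons : (sons (Set.univ : Set M)).Infinite) (I : PathExt M) {C : Set M} (hC : C ∈ I.1.1)
    (hpos : 0 < Metric.diam C) {F : Set (PathExt M)} (hF : F.Finite) (m : M) :
    ∃ J : PathExt M, dist I J = Metric.diam C ∧ (∀ z ∈ F, Metric.diam C ≤ dist J z) ∧
      ∀ t ∈ spec m, t < Metric.diam C → t ∈ Metric.diam '' J.1.1 := by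
  obtain ⟨S, hS, hsep⟩ := exists_infinite_separated hsons
  have hmax : ∀ b : M, ∃ t ∈ spec (b + m), t < Metric.diam C ∧
      ∀ s ∈ spec (b + m), s < Metric.diam C → s ≤ t := by
    intro b
    obtain ⟨t, ⟨ht, htC⟩, h⟩ := exists_max_of_wellFoundedOn_gt
      (spec_wellFoundedOn_of_nerve hwf (b + m)) (T := spec (b + m) ∩ Set.Iio (Metric.diam C))
      Set.inter_subset_left ⟨0, zero_mem_spec _, hpos⟩
    exact ⟨t, ht, htC, fun s h1 h2 => h s ⟨h1, h2⟩⟩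
  choose τ hτ hτC hτmax using hmax
  -- The largest ball around `b + m` of diameter less than that of `C`: any path closer than that to
  -- the switched path must contain it.
  let E : M → Set M := fun b => Metric.closedBall (b + m) (τ b)
  have hdisj : S.PairwiseDisjoint E := by
    intro x hx y hy hne
    refine Set.disjoint_left.2 fun z hzx hzy => ?_
    have h1 := hsep x hx y hy hne C
    rw [← hright x y m] at h1
    have h2 := IsUltrametricDist.dist_triangle_max (x + m) z (y + m)
    have hzx : dist z (x + m) ≤ τ x := hzx
    have hzy : dist z (y + m) ≤ τ y := hzy
    rw [dist_comm (x + m) z] at h2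
    have h3 := hτC x
    have h4 := hτC y
    rcases le_max_iff.1 h2 with h | h <;> linarith
  -- The path `I` is avoided too, which makes its distance to the switched path exactly the diameter
  -- of `C`.
  have hbad : (⋃ z ∈ insert I F, {b ∈ S | E b ∈ z.1.1}).Finite :=
    (hF.insert I).biUnion fun z _ => finite_setOf_mem_path z.1.2 hdisj
  obtain ⟨b, hbS, hb⟩ := (hS.sdiff hbad).nonempty
  have hb' : ∀ z ∈ insert I F, E b ∉ z.1.1 := fun z hz h =>
    hb (Set.mem_iUnion₂.2 ⟨z, hz, hbS, h⟩)
  let J := switchPath I hC hpos (b + m)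
  have hball : ∀ t ∈ spec (b + m), t < Metric.diam C →
      Metric.closedBall (b + m) t ∈ J.1.1 := fun t ht htC =>
    Or.inr ⟨closedBall_mem_nerve ht, mem_closedBall_of_mem_spec ht, by
      rwa [diam_closedBall_of_mem_spec ht]⟩
  have hfar : ∀ z ∈ insert I F, Metric.diam C ≤ dist J z := by
    intro z hz
    by_contra hlt
    refine hb' z hz (mem_of_dist_lt (hball _ (hτ b) (hτC b)) ?_ (not_le.1 hlt))
    rintro D (hD | ⟨hD, hbD, hDC⟩) hlt
    · exact absurd hlt hD.2
    · rw [diam_closedBall_of_mem_spec (hτ b)]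
      exact hτmax b _ (diam_mem_spec hD hbD) hDC
  refine ⟨J, le_antisymm (dist_switchPath_le I hC hpos _) ?_, fun z hz => hfar z (Or.inr hz), ?_⟩
  · rw [dist_comm]
    exact hfar I (Or.inl rfl)
  · intro t ht htC
    have ht' := spec_subset_spec_add_left hleft b m ht
    exact ⟨_, hball t ht' htC, diam_closedBall_of_mem_spec ht'⟩

theorem ample_pathExt [IsUltrametricDist M] [Countable M]
    (hleft : ∀ x y z : M, dist (z + x) (z + y) = dist x y)
    (hright : ∀ x y z : M, dist (x + z) (y + z) = dist x y)
    (hwf : (nerve M).WellFoundedOn (fun B C => C ⊂ B))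
    (hsons : (sons (Set.univ : Set M)).Infinite) : Ample (PathExt M) := by
  have hspec : ∀ I : PathExt M, Metric.diam '' I.1.1 ⊆ spec I := by
    rintro I _ ⟨C, hC, rfl⟩
    rcases (Metric.diam_nonneg (s := C)).eq_or_lt with h0 | hpos
    · rw [← h0]; exact zero_mem_spec I
    · obtain ⟨J, hJ, -⟩ := exists_switch hleft hright hwf hsons I hC hpos Set.finite_empty 0
      exact ⟨J, hJ⟩
  have hpoint : ∀ I : PathExt M, ∃ m : M, spec I ⊆ spec m := fun I => by
    obtain ⟨m, hm⟩ := exists_diam_subset_spec hleft hright I.1.2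
    exact ⟨m, (spec_subset_diam I).trans hm⟩
  refine ⟨inferInstance, fun I => ?_, fun I J => ?_, ?_⟩
  · obtain ⟨m, hm⟩ := hpoint I
    exact (spec_wellFoundedOn_of_nerve hwf m).subset hm
  · obtain ⟨a, ha⟩ := hpoint I
    obtain ⟨b, hb⟩ := hpoint J
    -- The path of all balls containing `a + b` dominates both spectra.
    have hpath : IsPath (gen {({a + b} : Set M)}) :=
      ⟨_, Set.finite_singleton _, Set.singleton_nonempty _,
        Set.singleton_subset_iff.2 (singleton_mem_nerve _), Set.injOn_singleton _ _, rfl⟩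
    have hmem : ∀ D ∈ nerve M, a + b ∈ D → D ∈ gen {({a + b} : Set M)} := fun D hD h =>
      ⟨hD, _, rfl, Set.singleton_subset_iff.2 h, by
        rintro _ rfl hlt; exact absurd hlt (lt_irrefl _)⟩
    let K : PathExt M := ⟨⟨_, hpath⟩,
      delta_eq_zero_of_singleton_mem (hmem _ (singleton_mem_nerve (a + b)) rfl)⟩
    have hK : spec (a + b) ⊆ spec K := fun t ht => hspec K
      ⟨_, hmem _ (closedBall_mem_nerve ht) (mem_closedBall_of_mem_spec ht),
        diam_closedBall_of_mem_spec ht⟩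
    exact ⟨K, (ha.trans (spec_subset_spec_add_right hright a b)).trans hK,
      (hb.trans (spec_subset_spec_add_left hleft a b)).trans hK⟩
  · intro I K r hr hpos F hF
    obtain ⟨C, hC, rfl⟩ := spec_subset_diam I hr
    obtain ⟨m, hm⟩ := hpoint K
    obtain ⟨J, hJ, hJF, hJt⟩ := exists_switch hleft hright hwf hsons I hC hpos hF m
    exact ⟨J, hJ, hJF, fun t ht htC => hspec J (hJt t (hm ht) htC)⟩

end Monoid

end PathExtension

theorem theorem11 {M : Type*} [MetricSpace M] [IsUltrametricDist M] [AddMonoid M] [Countable M]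
    (hleft : ∀ x y z : M, dist (z + x) (z + y) = dist x y)
    (hright : ∀ x y z : M, dist (x + z) (y + z) = dist x y)
    (hwf : (PathExtension.nerve M).WellFoundedOn (fun B C => C ⊂ B))
    (hsons : (PathExtension.sons (Set.univ : Set M)).Infinite) :
    PathExtension.SpecEndogeneous (PathExtension.PathExt M) ∧
      PathExtension.HereditarilyIndivisible (PathExtension.PathExt M) := by
  have h := PathExtension.ample_pathExt hleft hright hwf hsons
  exact ⟨h.specEndogeneous, h.hereditarilyIndivisible⟩
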